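/- Let $q\in\mathbb{C}$ be non-zero and not a root of unity. Let $U^+=U_q^+(B_2)$ be the $\mathbb{C}$-algebra generated by $e_1,e_2$ subject to the relations $$e_1^2e_2-(q^2+q^{-2})e_1e_2e_1+e_2e_1^2=0,$$ $$e_2^3e_1-(q^2+1+q^{-2})e_2^2e_1e_2+(q^2+1+q^{-2})e_2e_1e_2^2-e_1e_2^3=0.$$ Set $e_3=e_1e_2-q^2e_2e_1$, $\overline{e_3}=e_1e_2-q^{-2}e_2e_1$, $z=e_2e_3-q^2e_3e_2$ and $z'=(1-q^{-2})\bigl(e_3\overline{e_3}+(1+q^{-2})ze_1\bigr)$. For $(\alpha,\beta)\in\mathbb{C}^2\setminus\{(0,0)\}$, let $A_{\alpha,\beta}=U^+/\langle z-\alpha,\,z'-\beta\rangle$ be the quotient by the two-sided ideal generated by $z-\alpha$ and $z'-\beta$. Let $\mathbb{C}_{q^2}[x,y]$ be the quantum plane, i.e. the $\mathbb{C}$-algebra generated by $x,y$ subject to $xy=q^2yx$. Then $A_{\alpha,\beta}$ and $\mathbb{C}_{q^2}[x,y]$ are (left and right) Ore domains, and the skew field of fractions of $A_{\alpha,\beta}$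 is isomorphic, as a $\mathbb{C}$-algebra, to the skew field of fractions of $\mathbb{C}_{q^2}[x,y]$. -/

import Mathlib

open scoped OreLocalization nonZeroDivisors

noncomputable section

/-- The quantum Serre relations of type `B₂`, on the free algebra on two generators
(the generator `e₁` has index `0`, the generator `e₂` has index `1`). -/
inductive SerreB2 (q : ℂ) : FreeAlgebra ℂ (Fin 2) → FreeAlgebra ℂ (Fin 2) → Prop
  | rel₁ : SerreB2 q
      (FreeAlgebra.ι ℂ 0 ^ 2 * FreeAlgebra.ι ℂ 1
        - (q ^ 2 + (q ^ 2)⁻¹) • (FreeAlgebra.ι ℂ 0 * FreeAlgebra.ι ℂ 1 * FreeAlgebra.ι ℂ 0)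
        + FreeAlgebra.ι ℂ 1 * FreeAlgebra.ι ℂ 0 ^ 2) 0
  | rel₂ : SerreB2 q
      (FreeAlgebra.ι ℂ 1 ^ 3 * FreeAlgebra.ι ℂ 0
        - (q ^ 2 + 1 + (q ^ 2)⁻¹) •
            (FreeAlgebra.ι ℂ 1 ^ 2 * FreeAlgebra.ι ℂ 0 * FreeAlgebra.ι ℂ 1)
        + (q ^ 2 + 1 + (q ^ 2)⁻¹) •
            (FreeAlgebra.ι ℂ 1 * FreeAlgebra.ι ℂ 0 * FreeAlgebra.ι ℂ 1 ^ 2)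
        - FreeAlgebra.ι ℂ 0 * FreeAlgebra.ι ℂ 1 ^ 3) 0

/-- `U_q⁺(B₂)`: the `ℂ`-algebra generated by `e₁, e₂` subject to the quantum Serre relations. -/
abbrev UqB2 (q : ℂ) : Type := RingQuot (SerreB2 q)

namespace UqB2

variable (q : ℂ)

/-- The generator `e₁`. -/
def e₁ : UqB2 q := RingQuot.mkAlgHom ℂ (SerreB2 q) (FreeAlgebra.ι ℂ 0)

/-- The generator `e₂`. -/
def e₂ : UqB2 q := RingQuot.mkAlgHom ℂ (SerreB2 q) (FreeAlgebra.ι ℂ 1)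

/-- `e₃ = e₁ e₂ - q² e₂ e₁`. -/
def e₃ : UqB2 q := e₁ q * e₂ q - q ^ 2 • (e₂ q * e₁ q)

/-- `ē₃ = e₁ e₂ - q⁻² e₂ e₁`. -/
def e₃bar : UqB2 q := e₁ q * e₂ q - (q ^ 2)⁻¹ • (e₂ q * e₁ q)

/-- The central element `z = e₂ e₃ - q² e₃ e₂`. -/
def z : UqB2 q := e₂ q * e₃ q - q ^ 2 • (e₃ q * e₂ q)

/-- The central element `z' = (1 - q⁻²) (e₃ ē₃ + (1 + q⁻²) z e₁)`. -/
def z' : UqB2 q :=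
  (1 - (q ^ 2)⁻¹) • (e₃ q * e₃bar q + (1 + (q ^ 2)⁻¹) • (z q * e₁ q))

end UqB2

/-- The two-sided ideal `⟨z - α, z' - β⟩` of `U_q⁺(B₂)`. -/
def idealB2 (q α β : ℂ) : TwoSidedIdeal (UqB2 q) :=
  TwoSidedIdeal.span
    {UqB2.z q - algebraMap ℂ (UqB2 q) α, UqB2.z' q - algebraMap ℂ (UqB2 q) β}

/-- The factor algebra `A_{α,β} = U_q⁺(B₂) / ⟨z - α, z' - β⟩`. -/
abbrev AlgA (q α β : ℂ) : Type := (idealB2 q α β).ringCon.Quotient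

/-- The relation `x y = p y x` on the free algebra on two generators
(`x` has index `0`, `y` has index `1`). -/
inductive QuantumPlaneRel (p : ℂ) : FreeAlgebra ℂ (Fin 2) → FreeAlgebra ℂ (Fin 2) → Prop
  | rel : QuantumPlaneRel p (FreeAlgebra.ι ℂ 0 * FreeAlgebra.ι ℂ 1)
      (p • (FreeAlgebra.ι ℂ 1 * FreeAlgebra.ι ℂ 0))

/-- The quantum plane `ℂ_p[x, y]`: generators `x, y`, relation `x y = p y x`. -/
abbrev QuantumPlane (p : ℂ) : Type := RingQuot (QuantumPlaneRel p)

/-- The right Ore condition for the set of nonzero elements of a ring. Mathlib's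
`OreLocalization.OreSet` is the left Ore condition; a domain satisfying both has one
skew field of fractions, whose elements are the left fractions `s⁻¹ a` and also the right
fractions `a s⁻¹`. -/
def IsRightOre (R : Type*) [Ring R] : Prop :=
  ∀ a s : R, s ≠ 0 → ∃ a' s' : R, s' ≠ 0 ∧ a * s' = s * a'

/-- The skew field of fractions of a domain `R` satisfying the left Ore condition:
the localization of `R` at its nonzero elements. -/
abbrev SkewFrac (R : Type*) [Ring R] [OreLocalization.OreSet R⁰] : Type _ :=
  OreLocalization R⁰ R

end

/-! Put `p = q ^ 2` and `γ = β / (1 - q⁻²)`. In `A_{α,β}` the elements `e₃`, `e₁` satisfy `e₃ e₁ = p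
e₁ e₃`, and the relation `z' = β` expresses `e₃ e₂ e₁` as a polynomial in `e₁`, `e₃`. Once `e₁` and
`e₃` are invertible, `e₂` is therefore redundant, so the fraction field should be that of the
quantum plane. Solving for `e₂` gives `φ : A_{α,β} → Frac ℂ_p[x, y]` with `e₃ ↦ x`, `e₁ ↦ y`
(`factorRelations_divisionRing`, `AlgA.exists_lift`).

The main point is that `φ` is injective (`injective_of_comp_ofPlane`). Each element is a sum `∑ bⱼ
e₂ʲ` with `bⱼ` in the plane. For an element of the kernel, right multiplication by `(xy)ⁿ` clears
the powers of `e₂` and shows that the top coefficient vanishes modulo `x` and modulo `y`; this is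
where `(α, β) ≠ (0, 0)` enters. That coefficient is then divisible by `yx`, and since `e₁ e₃ e₂`
lies in the plane, the degree in `e₂` drops.

The plane is a domain because it acts on `ℂ[t]` by operators that shift large degrees, and it is Ore
by quadratic growth. As `A_{α,β}` lies between the plane and its fraction field, it inherits the
domain and Ore properties and has the same fractions. -/

open Polynomial

/-! ### Spanning and dimension-count tools -/

/-- A subspace containing `1` and stable under left multiplication by algebra generators is
everything. -/
theorem Submodule.eq_top_of_one_mem_of_adjoin {k A : Type*} [CommRing k] [Ring A] [Algebra k A]
    (S : Set A) (hS : Algebra.adjoin k S = ⊤) (M : Submodule k A) (h1 : 1 ∈ M)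
    (hM : ∀ s ∈ S, ∀ m ∈ M, s * m ∈ M) : M = ⊤ := by
  have key : ∀ a : A, ∀ m ∈ M, a * m ∈ M := by
    intro a
    have ha : a ∈ Algebra.adjoin k S := hS ▸ Algebra.mem_top
    induction ha using Algebra.adjoin_induction with
    | mem x hx => exact hM x hx
    | algebraMap r => intro m hm; rw [← Algebra.smul_def]; exact M.smul_mem r hm
    | add x y _ _ hx hy => intro m hm; rw [add_mul]; exact M.add_mem (hx m hm) (hy m hm)
    | mul x y _ _ hx hy => intro m hm; rw [mul_assoc]; exact hx _ (hy m hm)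
  rw [eq_top_iff]
  intro a _
  simpa using key a 1 h1

theorem RingQuot.adjoin_range_mkAlgHom_ι {k X : Type*} [CommRing k]
    (r : FreeAlgebra k X → FreeAlgebra k X → Prop) :
    Algebra.adjoin k (Set.range fun i => RingQuot.mkAlgHom k r (FreeAlgebra.ι k i)) = ⊤ := by
  have h : (Set.range fun i => RingQuot.mkAlgHom k r (FreeAlgebra.ι k i))
      = RingQuot.mkAlgHom k r '' Set.range (FreeAlgebra.ι k) := by
    rw [← Set.range_comp]; rfl
  rw [h, Algebra.adjoin_image, FreeAlgebra.adjoin_range_ι, Algebra.map_top,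
    AlgHom.range_eq_top]
  exact RingQuot.mkAlgHom_surjective k r

/-- If one of two linear endomorphisms of a space filtered by subspaces of dimension `(n + 1) ^ 2`
is injective and both shift the filtration by a bounded amount, then their ranges intersect. -/
theorem exists_eq_of_finrank_filtration {k R : Type*} [Field k] [AddCommGroup R] [Module k R]
    (V : ℕ → Submodule k R) (hfin : ∀ n, FiniteDimensional k (V n))
    (hV : ∀ n, Module.finrank k (V n) = (n + 1) ^ 2) (m : ℕ) (f g : R →ₗ[k] R)
    (hf : ∀ n, ∀ a ∈ V n, f a ∈ V (n + m)) (hg : ∀ n, ∀ a ∈ V n, g a ∈ V (n + m))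
    (hg0 : ∀ a, g a = 0 → a = 0) : ∃ a b, a ≠ 0 ∧ f a = g b := by
  -- The level `3m` makes the source larger than the target: `2(3m + 1)² > (4m + 1)²` for every `m`.
  let F : (V (3 * m) × V (3 * m)) →ₗ[k] V (3 * m + m) :=
    (f.restrict (hf (3 * m))).comp (LinearMap.fst k _ _)
      - (g.restrict (hg (3 * m))).comp (LinearMap.snd k _ _)
  have hker : LinearMap.ker F ≠ ⊥ := by
    apply LinearMap.ker_ne_bot_of_finrank_lt
    rw [Module.finrank_prod, hV, hV]
    have := Nat.zero_le (m * m)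
    ring_nf at this ⊢
    omega
  obtain ⟨⟨a, b⟩, hab, hne⟩ := (Submodule.ne_bot_iff _).1 hker
  have hfg : f a = g b := by
    have := congrArg Subtype.val (LinearMap.mem_ker.1 hab)
    simpa [F, sub_eq_zero] using this
  refine ⟨a, b, fun ha => hne ?_, hfg⟩
  have hb : (b : R) = 0 := hg0 _ (by rw [← hfg, ha, map_zero])
  ext <;> simp [ha, hb]

/-! ### The quantum plane: monomial basis and absence of zero divisors -/

namespace QuantumPlane

variable (p : ℂ)

/-- The generator `x` of the quantum plane. -/
noncomputable def x : QuantumPlane p := RingQuot.mkAlgHom ℂ (QuantumPlaneRel p) (FreeAlgebra.ι ℂ 0)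

/-- The generator `y` of the quantum plane. -/
noncomputable def y : QuantumPlane p := RingQuot.mkAlgHom ℂ (QuantumPlaneRel p) (FreeAlgebra.ι ℂ 1)

theorem x_mul_y : x p * y p = p • (y p * x p) := by
  have := RingQuot.mkAlgHom_rel ℂ (QuantumPlaneRel.rel (p := p))
  simpa [x, y] using this

theorem x_mul_y_pow (i : ℕ) : x p * y p ^ i = p ^ i • (y p ^ i * x p) := by
  induction i with
  | zero => simp
  | succ i ih =>
    rw [pow_succ, ← mul_assoc, ih, smul_mul_assoc, mul_assoc, x_mul_y, mul_smul_comm, smul_smul,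
      pow_succ, mul_assoc]

theorem x_pow_mul_y_pow (i j : ℕ) : x p ^ j * y p ^ i = p ^ (i * j) • (y p ^ i * x p ^ j) := by
  induction j with
  | zero => simp
  | succ j ih =>
    rw [pow_succ', mul_assoc, ih, mul_smul_comm, ← mul_assoc, x_mul_y_pow, smul_mul_assoc,
      smul_smul, mul_assoc, Nat.mul_succ, pow_add, mul_comm]

theorem adjoin_eq_top : Algebra.adjoin ℂ {x p, y p} = ⊤ := by
  rw [← RingQuot.adjoin_range_mkAlgHom_ι (QuantumPlaneRel p)]
  congr 1
  ext a
  simp [x, y, Fin.exists_fin_two, eq_comm]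

theorem span_monomials_eq_top :
    Submodule.span ℂ (Set.range fun ij : ℕ × ℕ => y p ^ ij.1 * x p ^ ij.2) = ⊤ := by
  apply Submodule.eq_top_of_one_mem_of_adjoin _ (adjoin_eq_top p)
  · exact Submodule.subset_span ⟨(0, 0), by simp⟩
  · intro s hs m hm
    induction hm using Submodule.span_induction with
    | zero => simp
    | add a b _ _ ha hb => rw [mul_add]; exact add_mem ha hb
    | smul c a _ ha => rw [mul_smul_comm]; exact Submodule.smul_mem _ _ ha
    | mem a ha =>
      obtain ⟨⟨i, j⟩, rfl⟩ := ha
      rcases hs with rfl | rfl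
      · simp only
        rw [← mul_assoc, x_mul_y_pow, smul_mul_assoc, mul_assoc, ← pow_succ']
        exact Submodule.smul_mem _ _ (Submodule.subset_span ⟨(i, j + 1), rfl⟩)
      · simp only
        rw [← mul_assoc, ← pow_succ']
        exact Submodule.subset_span ⟨(i + 1, j), rfl⟩

variable {p} in
/-- The algebra homomorphism out of the quantum plane given by `x ↦ a`, `y ↦ b`. -/
noncomputable def lift {B : Type*} [Ring B] [Algebra ℂ B] (a b : B) (h : a * b = p • (b * a)) :
    QuantumPlane p →ₐ[ℂ] B :=
  RingQuot.liftAlgHom ℂ ⟨FreeAlgebra.lift ℂ ![a, b], by rintro _ _ ⟨⟩; simpa using h⟩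

section lift
variable {p} {B : Type*} [Ring B] [Algebra ℂ B] (a b : B) (h : a * b = p • (b * a))

@[simp] theorem lift_x : lift a b h (x p) = a := by
  simp [lift, x, RingQuot.liftAlgHom_mkAlgHom_apply]

@[simp] theorem lift_y : lift a b h (y p) = b := by
  simp [lift, y, RingQuot.liftAlgHom_mkAlgHom_apply]

end lift

/-- The action of the quantum plane on polynomials: `y` multiplies by the variable `t` and `x`
sends `f(t)` to `f(p t)`. -/
noncomputable def action : QuantumPlane p →ₐ[ℂ] Module.End ℂ ℂ[X] :=
  lift (aeval (C p * X)).toLinearMap (LinearMap.mulLeft ℂ X) (by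
    refine LinearMap.ext fun f => ?_
    simp [smul_eq_C_mul, mul_assoc])

/-- `x` acts diagonally on the powers of `t`, with eigenvalue `p ^ m` on `t ^ m`. -/
theorem action_aeval_x_coeff (g f : ℂ[X]) (m : ℕ) :
    (action p (aeval (x p) g) f).coeff m = g.eval (p ^ m) * f.coeff m := by
  induction g using Polynomial.induction_on' generalizing f m with
  | add g₁ g₂ h₁ h₂ => simp [h₁, h₂, add_mul]
  | monomial n c =>
    have hx : ∀ f : ℂ[X], (action p (x p) f).coeff m = p ^ m * f.coeff m := by
      intro f
      simp only [action, lift_x, AlgHom.toLinearMap_apply]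
      rw [← comp_eq_aeval, comp_C_mul_X_coeff, mul_comm]
    have hn : (((action p (x p)) ^ n) f).coeff m = (p ^ m) ^ n * f.coeff m := by
      induction n with
      | zero => simp
      | succ n ih => rw [pow_succ', Module.End.mul_apply, hx, ih]; ring
    rw [aeval_monomial, map_mul, AlgHom.commutes, map_pow, Module.End.mul_apply,
      Module.algebraMap_end_apply, coeff_smul, hn, eval_monomial, smul_eq_mul, mul_assoc]

theorem action_y_pow (i : ℕ) (f : ℂ[X]) : action p (y p ^ i) f = X ^ i * f := by
  induction i with
  | zero => simp
  | succ i ih => rw [pow_succ', map_mul, Module.End.mul_apply, ih]; simp [action]; ring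

/-- The linear map sending a finitely supported family of polynomials `gᵢ` to `∑ yⁱ gᵢ(x)`. -/
noncomputable def ofCoeff : (ℕ →₀ ℂ[X]) →ₗ[ℂ] QuantumPlane p :=
  Finsupp.lsum ℂ fun i => (LinearMap.mulLeft ℂ (y p ^ i)).comp (aeval (x p)).toLinearMap

theorem ofCoeff_single (i : ℕ) (g : ℂ[X]) :
    ofCoeff p (Finsupp.single i g) = y p ^ i * aeval (x p) g := by
  simp [ofCoeff]

theorem ofCoeff_surjective : Function.Surjective (ofCoeff p) := by
  rw [← LinearMap.range_eq_top, eq_top_iff, ← span_monomials_eq_top p, Submodule.span_le]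
  rintro _ ⟨⟨i, j⟩, rfl⟩
  exact ⟨Finsupp.single i (X ^ j), by simp [ofCoeff_single]⟩

theorem degree_action_aeval_x_le (g f : ℂ[X]) : (action p (aeval (x p) g) f).degree ≤ f.degree := by
  rw [degree_le_iff_coeff_zero]
  intro m hm
  rw [action_aeval_x_coeff, coeff_eq_zero_of_degree_lt hm, mul_zero]

/-- The element `a` shifts the degree of all polynomials of large degree by a fixed amount. -/
def ShiftsDegree (a : QuantumPlane p) : Prop :=
  ∃ N d : ℕ, ∀ f : ℂ[X], f ≠ 0 → N ≤ f.natDegree →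
    action p a f ≠ 0 ∧ (action p a f).natDegree = d + f.natDegree

variable {p}

theorem ShiftsDegree.mul {a b : QuantumPlane p} (ha : ShiftsDegree p a) (hb : ShiftsDegree p b) :
    ShiftsDegree p (a * b) := by
  obtain ⟨N, d, ha⟩ := ha
  obtain ⟨N', d', hb⟩ := hb
  refine ⟨N + N', d + d', fun f hf hN => ?_⟩
  obtain ⟨h1, h2⟩ := hb f hf (by omega)
  obtain ⟨h3, h4⟩ := ha _ h1 (by omega)
  rw [map_mul, Module.End.mul_apply]
  exact ⟨h3, by omega⟩

theorem ShiftsDegree.ne_zero {a : QuantumPlane p} (ha : ShiftsDegree p a) : a ≠ 0 := by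
  rintro rfl
  obtain ⟨N, d, ha⟩ := ha
  exact (ha (X ^ N) (by simp) (by simp)).1 (by simp)

/-- A nonzero polynomial has finitely many roots, and the powers of `p` are distinct. -/
theorem exists_eval_pow_ne_zero (hp : Function.Injective fun n : ℕ => p ^ n) {g : ℂ[X]}
    (hg : g ≠ 0) : ∃ N, ∀ n, N ≤ n → g.eval (p ^ n) ≠ 0 := by
  have hfin : {n : ℕ | g.eval (p ^ n) = 0}.Finite := by
    have := g.roots.toFinset.finite_toSet.preimage (f := fun n : ℕ => p ^ n) hp.injOn
    refine this.subset fun n hn => ?_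
    simpa [hg] using hn
  obtain ⟨N, hN⟩ := hfin.bddAbove
  exact ⟨N + 1, fun n hn h => by have := hN h; omega⟩

/-- Polynomials in `x` never raise the degree, so the highest power `y ^ d` dominates, provided its
coefficient `G d` does not kill the leading term of `f`; this holds once `f` has large degree. -/
theorem shiftsDegree_ofCoeff (hp : Function.Injective fun n : ℕ => p ^ n) {G : ℕ →₀ ℂ[X]}
    (hG : G ≠ 0) : ShiftsDegree p (ofCoeff p G) := by
  have hne : G.support.Nonempty := Finsupp.support_nonempty_iff.2 hG
  set d := G.support.max' hne with hd
  have hGd : G d ≠ 0 := Finsupp.mem_support_iff.1 (Finset.max'_mem _ hne)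
  obtain ⟨N, hN⟩ := exists_eval_pow_ne_zero hp hGd
  refine ⟨N, d, fun f hf hfN => ?_⟩
  suffices h : (action p (ofCoeff p G) f).degree = ((d + f.natDegree : ℕ) : WithBot ℕ) by
    refine ⟨fun h0 => ?_, natDegree_eq_of_degree_eq_some h⟩
    rw [h0, degree_zero] at h
    exact WithBot.bot_ne_coe h
  have hsplit : action p (ofCoeff p G) f = (∑ i ∈ G.support.erase d,
      X ^ i * action p (aeval (x p) (G i)) f) + X ^ d * action p (aeval (x p) (G d)) f := by
    rw [Finset.sum_erase_add _ _ (Finset.max'_mem _ hne)]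
    simp [ofCoeff, Finsupp.sum, ← action_y_pow p, -map_pow]
  have htop : (action p (aeval (x p) (G d)) f).degree = f.natDegree := by
    apply le_antisymm
    · rw [← degree_eq_natDegree hf]; exact degree_action_aeval_x_le p _ _
    · apply le_degree_of_ne_zero
      rw [action_aeval_x_coeff]
      exact mul_ne_zero (hN _ hfN) (leadingCoeff_ne_zero.2 hf)
  have htop' : (X ^ d * action p (aeval (x p) (G d)) f).degree
      = ((d + f.natDegree : ℕ) : WithBot ℕ) := by
    rw [degree_mul, htop, degree_X_pow]; rfl
  rw [hsplit, degree_add_eq_right_of_degree_lt, htop']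
  rw [htop']
  refine (degree_sum_le _ _).trans_lt ?_
  rw [Finset.sup_lt_iff (WithBot.bot_lt_coe _)]
  intro i hi
  have hid : i < d := Finset.lt_max'_of_mem_erase_max' _ hne hi
  have h1 := degree_action_aeval_x_le p (G i) f
  rw [degree_eq_natDegree hf] at h1
  rw [degree_mul, degree_X_pow]
  calc (i : WithBot ℕ) + _ ≤ i + f.natDegree := by gcongr
    _ = ((i + f.natDegree : ℕ) : WithBot ℕ) := rfl
    _ < _ := by exact_mod_cast (by omega)

theorem ofCoeff_injective (hp : Function.Injective fun n : ℕ => p ^ n) :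
    Function.Injective (ofCoeff p) := by
  rw [injective_iff_map_eq_zero]
  intro G h
  by_contra hG
  exact (shiftsDegree_ofCoeff hp hG).ne_zero h

theorem shiftsDegree (hp : Function.Injective fun n : ℕ => p ^ n) {a : QuantumPlane p}
    (ha : a ≠ 0) : ShiftsDegree p a := by
  obtain ⟨G, rfl⟩ := ofCoeff_surjective p a
  exact shiftsDegree_ofCoeff hp (by rintro rfl; simp at ha)

theorem isDomain (hp : Function.Injective fun n : ℕ => p ^ n) : IsDomain (QuantumPlane p) := by
  have : Nontrivial (QuantumPlane p) :=
    ⟨1, 0, ShiftsDegree.ne_zero ⟨0, 0, fun f hf _ => by simpa using hf⟩⟩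
  have : NoZeroDivisors (QuantumPlane p) := ⟨fun {a b} hab => by
    by_contra! h
    exact ((shiftsDegree hp h.1).mul (shiftsDegree hp h.2)).ne_zero hab⟩
  exact NoZeroDivisors.to_isDomain _

theorem linearIndependent_monomials (hp : Function.Injective fun n : ℕ => p ^ n) :
    LinearIndependent ℂ fun ij : ℕ × ℕ => y p ^ ij.1 * x p ^ ij.2 := by
  have h := (Finsupp.basis fun _ : ℕ => basisMonomials ℂ).linearIndependent.map' (ofCoeff p)
    (LinearMap.ker_eq_bot.2 (ofCoeff_injective hp))
  have h' := h.comp (fun ij : ℕ × ℕ => (⟨ij.1, ij.2⟩ : Σ _ : ℕ, ℕ))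
    (fun a b hab => by cases a; cases b; simpa using hab)
  have he : (fun ij : ℕ × ℕ => y p ^ ij.1 * x p ^ ij.2)
      = (ofCoeff p ∘ Finsupp.basis fun _ : ℕ => basisMonomials ℂ) ∘
        (fun ij : ℕ × ℕ => (⟨ij.1, ij.2⟩ : Σ _ : ℕ, ℕ)) := by
    ext ⟨i, j⟩
    simp [ofCoeff_single]
  rw [he]
  exact h'

/-! ### Quadratic growth and the two Ore conditions for the plane -/

variable (p) in
/-- The span of the monomials `yⁱ xʲ` with `i, j ≤ n`. -/
noncomputable def boxSpan (n : ℕ) : Submodule ℂ (QuantumPlane p) :=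
  Submodule.span ℂ (Set.range fun ij : Fin (n + 1) × Fin (n + 1) =>
    y p ^ (ij.1 : ℕ) * x p ^ (ij.2 : ℕ))

theorem monomial_mem_boxSpan {n i j : ℕ} (hi : i ≤ n) (hj : j ≤ n) :
    y p ^ i * x p ^ j ∈ boxSpan p n :=
  Submodule.subset_span ⟨(⟨i, by omega⟩, ⟨j, by omega⟩), rfl⟩

theorem finrank_boxSpan (hp : Function.Injective fun n : ℕ => p ^ n) (n : ℕ) :
    Module.finrank ℂ (boxSpan p n) = (n + 1) ^ 2 := by
  have h := (linearIndependent_monomials hp).comp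
    (fun ij : Fin (n + 1) × Fin (n + 1) => ((ij.1 : ℕ), (ij.2 : ℕ)))
    (fun a b hab => by
      simp only [Prod.mk.injEq] at hab
      exact Prod.ext (Fin.ext hab.1) (Fin.ext hab.2))
  exact (finrank_span_eq_card h).trans (by simp [sq])

theorem boxSpan_mono {m n : ℕ} (h : m ≤ n) : boxSpan p m ≤ boxSpan p n := by
  refine Submodule.span_le.2 ?_
  rintro _ ⟨⟨i, j⟩, rfl⟩
  exact monomial_mem_boxSpan (by omega) (by omega)

theorem exists_mem_boxSpan (a : QuantumPlane p) : ∃ n, a ∈ boxSpan p n := by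
  have ha : a ∈ Submodule.span ℂ (Set.range fun ij : ℕ × ℕ => y p ^ ij.1 * x p ^ ij.2) := by
    rw [span_monomials_eq_top]; trivial
  induction ha using Submodule.span_induction with
  | mem _ h =>
    obtain ⟨⟨i, j⟩, rfl⟩ := h
    exact ⟨i + j, monomial_mem_boxSpan (by omega) (by omega)⟩
  | zero => exact ⟨0, zero_mem _⟩
  | add a b _ _ ha hb =>
    obtain ⟨m, hm⟩ := ha
    obtain ⟨n, hn⟩ := hb
    exact ⟨m + n, add_mem (boxSpan_mono (by omega) hm) (boxSpan_mono (by omega) hn)⟩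
  | smul c a _ ha =>
    obtain ⟨m, hm⟩ := ha
    exact ⟨m, Submodule.smul_mem _ _ hm⟩

theorem mul_mem_boxSpan {m n : ℕ} {a b : QuantumPlane p} (ha : a ∈ boxSpan p m)
    (hb : b ∈ boxSpan p n) : a * b ∈ boxSpan p (m + n) := by
  have h : boxSpan p m * boxSpan p n ≤ boxSpan p (m + n) := by
    rw [boxSpan, boxSpan, Submodule.span_mul_span, Submodule.span_le]
    rintro _ ⟨_, ⟨⟨i, j⟩, rfl⟩, _, ⟨⟨k, l⟩, rfl⟩, rfl⟩
    have : y p ^ (i : ℕ) * x p ^ (j : ℕ) * (y p ^ (k : ℕ) * x p ^ (l : ℕ))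
        = p ^ ((k : ℕ) * j) • (y p ^ ((i : ℕ) + k) * x p ^ ((j : ℕ) + l)) := by
      rw [mul_assoc, ← mul_assoc (x p ^ (j : ℕ)), x_pow_mul_y_pow, smul_mul_assoc, mul_smul_comm,
        pow_add, pow_add]
      simp only [mul_assoc]
    simp only [SetLike.mem_coe, this]
    exact Submodule.smul_mem _ _ (monomial_mem_boxSpan (by omega) (by omega))
  exact h (Submodule.mul_mem_mul ha hb)

theorem exists_left_mul_eq (hp : Function.Injective fun n : ℕ => p ^ n) (a s : QuantumPlane p)
    (hs : s ≠ 0) : ∃ a' s', s' ≠ 0 ∧ s' * a = a' * s := by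
  have := isDomain hp
  obtain ⟨m, ha⟩ := exists_mem_boxSpan a
  obtain ⟨n, hn⟩ := exists_mem_boxSpan s
  obtain ⟨u, v, hu, h⟩ := exists_eq_of_finrank_filtration (boxSpan p)
    (fun n => FiniteDimensional.span_of_finite ℂ (Set.finite_range _)) (finrank_boxSpan hp) (m + n)
    (LinearMap.mulRight ℂ a) (LinearMap.mulRight ℂ s)
    (fun k b hb => mul_mem_boxSpan hb (boxSpan_mono (by omega) ha))
    (fun k b hb => mul_mem_boxSpan hb (boxSpan_mono (by omega) hn))
    (fun b hb => (mul_eq_zero.1 hb).resolve_right hs)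
  exact ⟨v, u, hu, h⟩

theorem isRightOre (hp : Function.Injective fun n : ℕ => p ^ n) :
    IsRightOre (QuantumPlane p) := by
  intro a s hs
  have := isDomain hp
  obtain ⟨m, ha⟩ := exists_mem_boxSpan a
  obtain ⟨n, hn⟩ := exists_mem_boxSpan s
  obtain ⟨u, v, hu, h⟩ := exists_eq_of_finrank_filtration (boxSpan p)
    (fun n => FiniteDimensional.span_of_finite ℂ (Set.finite_range _)) (finrank_boxSpan hp) (m + n)
    (LinearMap.mulLeft ℂ a) (LinearMap.mulLeft ℂ s)
    (fun k b hb => by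
      rw [add_comm]; exact mul_mem_boxSpan (boxSpan_mono (by omega) ha) hb)
    (fun k b hb => by
      rw [add_comm]; exact mul_mem_boxSpan (boxSpan_mono (by omega) hn) hb)
    (fun b hb => (mul_eq_zero.1 hb).resolve_left hs)
  exact ⟨v, u, hu, h⟩

theorem nonempty_oreSet (hp : Function.Injective fun n : ℕ => p ^ n) :
    Nonempty (OreLocalization.OreSet (QuantumPlane p)⁰) := by
  have := isDomain hp
  rw [OreLocalization.nonempty_oreSet_iff_of_noZeroDivisors]
  rintro r ⟨s, hs⟩
  obtain ⟨a', s', hs', h⟩ := exists_left_mul_eq hp r s (nonZeroDivisors.ne_zero hs)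
  exact ⟨a', ⟨s', mem_nonZeroDivisors_of_ne_zero hs'⟩, h⟩

end QuantumPlane

/-! ### The relations of the factor algebra and their solution in a skew field -/

/-- The relations in the factor algebra of `U_q⁺(B₂)` in terms of `e₁`, `e₂`, `e₃`, where
`p = q ^ 2` and `γ = β / (1 - q⁻²)`. -/
structure FactorRelations (p α γ : ℂ) {B : Type*} [Ring B] [Algebra ℂ B] (e₁ e₂ e₃ : B) : Prop where
  e₁_mul_e₂ : e₁ * e₂ = e₃ + p • (e₂ * e₁)
  e₃_mul_e₁ : e₃ * e₁ = p • (e₁ * e₃)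
  e₂_mul_e₃ : e₂ * e₃ = p • (e₃ * e₂) + α • 1
  e₃_mul_e₂_mul_e₁ : e₃ * (e₂ * e₁)
    = (p - p⁻¹)⁻¹ • (γ • 1 - ((1 + p⁻¹) * α) • e₁ - e₃ * e₃)

/-- The last relation forces the value of `e₂`. The relations involving it are verified after
multiplying by `v` on the left and `u` on the right, which removes all inverses. -/
theorem factorRelations_divisionRing {p : ℂ} (hp0 : p ≠ 0) (hp' : p ^ 2 - 1 ≠ 0) (α γ : ℂ)
    {K : Type*} [DivisionRing K] [Algebra ℂ K] {u v : K} (hu : u ≠ 0) (hv : v ≠ 0)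
    (h : v * u = p • (u * v)) :
    FactorRelations p α γ u
      (v⁻¹ * ((p - p⁻¹)⁻¹ • (γ • 1 - ((1 + p⁻¹) * α) • u - v * v)) * u⁻¹) v := by
  set N : K := (p - p⁻¹)⁻¹ • (γ • 1 - ((1 + p⁻¹) * α) • u - v * v) with hN
  set g := v⁻¹ * N * u⁻¹ with hg
  have hvgu : v * (g * u) = N := by
    rw [hg, inv_mul_cancel_right₀ hu, mul_inv_cancel_left₀ hv]
  have hvvu : v * (v * u) = p ^ 2 • (u * (v * v)) := by
    rw [h, mul_smul_comm, ← mul_assoc, h, smul_mul_assoc, smul_smul, mul_assoc, sq]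
  have hp'' : p + 1 ≠ 0 := by
    intro h0; apply hp'; linear_combination (p - 1) * h0
  refine ⟨?_, h, ?_, hvgu⟩
  · apply mul_left_cancel₀ hv
    apply mul_right_cancel₀ hu
    have h1 : v * (u * g) * u = p • (u * N) := by
      rw [← hvgu, ← mul_assoc v u, h]; simp only [smul_mul_assoc, mul_assoc]
    have h2 : v * (v + p • (g * u)) * u = v * (v * u) + p • (N * u) := by
      rw [← hvgu]; simp only [smul_mul_assoc, mul_assoc, mul_add, add_mul, mul_smul_comm]
    rw [h1, h2, hvvu, hN]
    simp only [smul_mul_assoc, mul_smul_comm, mul_sub, sub_mul, mul_assoc, hvvu, mul_one, one_mul]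
    match_scalars <;> field_simp <;> ring
  · apply mul_left_cancel₀ hv
    apply mul_right_cancel₀ hu
    have h1 : v * (g * v) * u = p • (N * v) := by
      rw [← hvgu, mul_assoc, mul_assoc, h]; simp only [mul_smul_comm, mul_assoc]
    have h2 : v * (p • (v * g) + α • 1) * u = p • (v * N) + α • (v * u) := by
      rw [← hvgu]
      simp only [smul_mul_assoc, mul_assoc, mul_add, add_mul, mul_smul_comm, mul_one]
    rw [h1, h2, hN]
    simp only [smul_mul_assoc, mul_smul_comm, mul_sub, sub_mul, mul_assoc, h, mul_one, one_mul]
    match_scalars <;> field_simp <;> ring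

/-- Up to the factor `-p⁻¹`, this is `e₃ e₁ = p e₁ e₃` with `e₃` expanded. -/
theorem FactorRelations.serre₁ {p α γ : ℂ} (hp0 : p ≠ 0) {B : Type*} [Ring B] [Algebra ℂ B]
    {e₁ e₂ e₃ : B} (h : FactorRelations p α γ e₁ e₂ e₃) :
    e₁ ^ 2 * e₂ - (p + p⁻¹) • (e₁ * e₂ * e₁) + e₂ * e₁ ^ 2 = 0 := by
  have h1 : e₁ * e₂ - p • (e₂ * e₁) = e₃ := by rw [h.e₁_mul_e₂]; abel
  have h2 := h.e₃_mul_e₁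
  rw [← h1] at h2
  simp only [smul_mul_assoc, mul_smul_comm, mul_sub, sub_mul, mul_assoc, smul_sub] at h2
  have h3 : p⁻¹ • (e₁ * (e₂ * e₁) - p • (e₂ * (e₁ * e₁)))
      - p⁻¹ • (p • (e₁ * (e₁ * e₂)) - p • p • (e₁ * (e₂ * e₁))) = 0 := by rw [h2, sub_self]
  simp only [sq, mul_assoc]
  rw [← neg_eq_zero, ← h3]
  match_scalars <;> field_simp <;> ring

/-- Up to the factor `-p⁻¹`, this says that `e₂` commutes with the scalar `e₂ e₃ - p e₃ e₂`. -/
theorem FactorRelations.serre₂ {p α γ : ℂ} (hp0 : p ≠ 0) {B : Type*} [Ring B] [Algebra ℂ B]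
    {e₁ e₂ e₃ : B} (h : FactorRelations p α γ e₁ e₂ e₃) :
    e₂ ^ 3 * e₁ - (p + 1 + p⁻¹) • (e₂ ^ 2 * e₁ * e₂) + (p + 1 + p⁻¹) • (e₂ * e₁ * e₂ ^ 2)
      - e₁ * e₂ ^ 3 = 0 := by
  have h1 : e₁ * e₂ - p • (e₂ * e₁) = e₃ := by rw [h.e₁_mul_e₂]; abel
  have h2 : e₂ * (e₂ * e₃ - p • (e₃ * e₂)) - (e₂ * e₃ - p • (e₃ * e₂)) * e₂ = 0 := by
    rw [h.e₂_mul_e₃]; simp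
  rw [← h1] at h2
  have h3 : p⁻¹ • (e₂ * (e₂ * (e₁ * e₂ - p • (e₂ * e₁)) - p • ((e₁ * e₂ - p • (e₂ * e₁)) * e₂))
    - (e₂ * (e₁ * e₂ - p • (e₂ * e₁)) - p • ((e₁ * e₂ - p • (e₂ * e₁)) * e₂)) * e₂) = 0 := by
    rw [h2, smul_zero]
  rw [← neg_eq_zero, ← h3]
  simp only [smul_mul_assoc, mul_smul_comm, mul_sub, sub_mul, mul_assoc, smul_sub, pow_succ,
    pow_zero, one_mul]
  match_scalars <;> field_simp <;> ring

/-! ### Presentation and universal property of the factor algebra -/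

namespace AlgA

variable (q α β : ℂ)

/-- The quotient map `U_q⁺(B₂) → A_{α,β}`. -/
def mk : UqB2 q →ₐ[ℂ] AlgA q α β :=
  { (idealB2 q α β).ringCon.mk' with commutes' := fun _ => rfl }

theorem mk_surjective : Function.Surjective (mk q α β) :=
  (idealB2 q α β).ringCon.mk'_surjective

theorem adjoin_eq_top :
    Algebra.adjoin ℂ {mk q α β (UqB2.e₁ q), mk q α β (UqB2.e₂ q)} = ⊤ := by
  have h : ({mk q α β (UqB2.e₁ q), mk q α β (UqB2.e₂ q)} : Set (AlgA q α β))
      = mk q α β '' (Set.range fun i =>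
        RingQuot.mkAlgHom ℂ (SerreB2 q) (FreeAlgebra.ι ℂ i)) := by
    ext a
    simp [UqB2.e₁, UqB2.e₂, Fin.exists_fin_two, eq_comm]
  rw [h, Algebra.adjoin_image, RingQuot.adjoin_range_mkAlgHom_ι, Algebra.map_top,
    AlgHom.range_eq_top]
  exact mk_surjective q α β

theorem mk_z : mk q α β (UqB2.z q) = algebraMap ℂ _ α := by
  rw [← AlgHom.commutes (mk q α β)]
  refine (RingCon.eq _).2 ((TwoSidedIdeal.rel_iff _ _ _).2 ?_)
  exact TwoSidedIdeal.subset_span (by simp)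

theorem mk_z' : mk q α β (UqB2.z' q) = algebraMap ℂ _ β := by
  rw [← AlgHom.commutes (mk q α β)]
  refine (RingCon.eq _).2 ((TwoSidedIdeal.rel_iff _ _ _).2 ?_)
  exact TwoSidedIdeal.subset_span (by simp)

variable {q} in
theorem factorRelations (hq0 : q ≠ 0) (hq : (q ^ 2) ^ 2 - 1 ≠ 0) :
    FactorRelations (q ^ 2) α (β / (1 - (q ^ 2)⁻¹)) (mk q α β (UqB2.e₁ q)) (mk q α β (UqB2.e₂ q))
      (mk q α β (UqB2.e₃ q)) := by
  have hz := mk_z q α β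
  have hz' := mk_z' q α β
  have hs := RingQuot.mkAlgHom_rel ℂ (SerreB2.rel₁ (q := q))
  have he : mk q α β (UqB2.e₃ q) = mk q α β (UqB2.e₁ q) * mk q α β (UqB2.e₂ q)
      - q ^ 2 • (mk q α β (UqB2.e₂ q) * mk q α β (UqB2.e₁ q)) := by
    simp [UqB2.e₃]
  have hs' : mk q α β (UqB2.e₁ q) ^ 2 * mk q α β (UqB2.e₂ q)
      - (q ^ 2 + (q ^ 2)⁻¹) •
        (mk q α β (UqB2.e₁ q) * mk q α β (UqB2.e₂ q) * mk q α β (UqB2.e₁ q))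
      + mk q α β (UqB2.e₂ q) * mk q α β (UqB2.e₁ q) ^ 2 = 0 := by
    have := congrArg (mk q α β) hs
    simpa [UqB2.e₁, UqB2.e₂] using this
  have hb : mk q α β (UqB2.e₃bar q) = mk q α β (UqB2.e₁ q) * mk q α β (UqB2.e₂ q)
      - (q ^ 2)⁻¹ • (mk q α β (UqB2.e₂ q) * mk q α β (UqB2.e₁ q)) := by
    simp [UqB2.e₃bar]
  rw [UqB2.z', map_smul, map_add, map_smul, map_mul, map_mul, hz, hb] at hz'
  rw [UqB2.z, map_sub, map_smul, map_mul, map_mul] at hz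
  set p := q ^ 2 with hp
  have hp0 : p ≠ 0 := pow_ne_zero 2 hq0
  have hp1 : 1 - p⁻¹ ≠ 0 := by
    intro h0; apply hq; field_simp at h0; linear_combination (p + 1) * h0
  set E₁ := mk q α β (UqB2.e₁ q)
  set E₂ := mk q α β (UqB2.e₂ q)
  set E₃ := mk q α β (UqB2.e₃ q)
  have h12 : E₁ * E₂ = E₃ + p • (E₂ * E₁) := by rw [he]; abel
  refine ⟨h12, ?_, ?_, ?_⟩
  · rw [← sub_eq_zero, ← smul_eq_zero_iff_right (neg_ne_zero.2 (inv_ne_zero hp0)), ← hs', he]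
    simp only [smul_mul_assoc, mul_smul_comm, mul_sub, sub_mul, mul_assoc, sq]
    match_scalars <;> field_simp <;> ring
  · rw [← Algebra.algebraMap_eq_smul_one, ← hz]; abel
  -- This is `ē₃ = e₃ + (p - p⁻¹) e₂ e₁` multiplied by `e₃` on the left; the value of `e₃ ē₃` then
  -- comes from `z' = β`.
  · have h3 : E₃ * (E₂ * E₁) = (p - p⁻¹)⁻¹ • (E₃ * (E₁ * E₂ - p⁻¹ • (E₂ * E₁)) - E₃ * E₃) := by
      rw [h12]
      simp only [mul_add, mul_sub, mul_smul_comm]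
      match_scalars <;> field_simp <;> ring
    have h4 : E₃ * (E₁ * E₂ - p⁻¹ • (E₂ * E₁))
        = (β / (1 - p⁻¹)) • 1 - ((1 + p⁻¹) * α) • E₁ := by
      rw [div_eq_inv_mul, mul_smul, ← Algebra.algebraMap_eq_smul_one, ← hz', smul_smul,
        inv_mul_cancel₀ hp1, one_smul, ← Algebra.smul_def, smul_smul, add_sub_cancel_right]
    rw [h3, h4]

variable {q α β} in
theorem exists_lift (hq0 : q ≠ 0) (hq : (q ^ 2) ^ 2 - 1 ≠ 0)
    {B : Type*} [Ring B] [Algebra ℂ B] {e₁ e₂ e₃ : B}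
    (h : FactorRelations (q ^ 2) α (β / (1 - (q ^ 2)⁻¹)) e₁ e₂ e₃) :
    ∃ φ : AlgA q α β →ₐ[ℂ] B, φ (mk q α β (UqB2.e₁ q)) = e₁ ∧ φ (mk q α β (UqB2.e₂ q)) = e₂ ∧
      φ (mk q α β (UqB2.e₃ q)) = e₃ := by
  have hp0 : q ^ 2 ≠ 0 := pow_ne_zero 2 hq0
  let f : UqB2 q →ₐ[ℂ] B := RingQuot.liftAlgHom ℂ ⟨FreeAlgebra.lift ℂ ![e₁, e₂], by
    rintro _ _ (_ | _)
    · simpa using h.serre₁ hp0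
    · simpa using h.serre₂ hp0⟩
  have f₁ : f (UqB2.e₁ q) = e₁ := by
    simp [f, UqB2.e₁, RingQuot.liftAlgHom_mkAlgHom_apply]
  have f₂ : f (UqB2.e₂ q) = e₂ := by
    simp [f, UqB2.e₂, RingQuot.liftAlgHom_mkAlgHom_apply]
  have f₃ : f (UqB2.e₃ q) = e₃ := by
    rw [UqB2.e₃, map_sub, map_smul, map_mul, map_mul, f₁, f₂, h.e₁_mul_e₂]; abel
  have fz : f (UqB2.z q) = algebraMap ℂ B α := by
    rw [UqB2.z, map_sub, map_smul, map_mul, map_mul, f₂, f₃, h.e₂_mul_e₃,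
      Algebra.algebraMap_eq_smul_one]
    abel
  have fz' : f (UqB2.z' q) = algebraMap ℂ B β := by
    rw [UqB2.z', UqB2.e₃bar]
    simp only [map_smul, map_add, map_mul, map_sub, f₁, f₂, f₃, fz]
    rw [h.e₁_mul_e₂, ← Algebra.smul_def, Algebra.algebraMap_eq_smul_one]
    simp only [mul_add, mul_sub, mul_smul_comm, h.e₃_mul_e₂_mul_e₁]
    have hq₁ : q ^ 2 - 1 ≠ 0 := by
      intro h0; apply hq; linear_combination (q ^ 2 + 1) * h0
    clear_value f
    clear h
    generalize q ^ 2 = p at *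
    match_scalars <;> field_simp <;> ring
  have hle : (idealB2 q α β).ringCon ≤ RingCon.ker f.toRingHom := by
    refine RingCon.ringConGen_le.2 fun a b hab => ?_
    have hab' : f (a - b) = 0 := by
      rcases hab with hab | hab <;> rw [hab]
      · simp [fz]
      · simp [fz']
    rw [map_sub, sub_eq_zero] at hab'
    exact hab'
  exact ⟨RingCon.liftₐ _ f hle, f₁, f₂, f₃⟩

end AlgA

/-! ### Reduction of the plane modulo `x` and modulo `y` -/

namespace QuantumPlane

variable (p : ℂ)

/-- The quotient map of the quantum plane by the ideal generated by `x`. -/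
noncomputable def modX : QuantumPlane p →ₐ[ℂ] ℂ[X] := lift 0 X (by simp)

/-- The quotient map of the quantum plane by the ideal generated by `y`. -/
noncomputable def modY : QuantumPlane p →ₐ[ℂ] ℂ[X] := lift X 0 (by simp)

@[simp] theorem modX_x : modX p (x p) = 0 := lift_x _ _ _
@[simp] theorem modX_y : modX p (y p) = X := lift_y _ _ _
@[simp] theorem modY_x : modY p (x p) = X := lift_x _ _ _
@[simp] theorem modY_y : modY p (y p) = 0 := lift_y _ _ _

variable {p}

/-- Monomials are sorted into pure powers of `x`, positive powers of `y`, and mixed ones; the mixed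
ones have `yx` as a right factor up to a power of `p`. -/
theorem exists_eq_aeval_add (hp0 : p ≠ 0) (b : QuantumPlane p) : ∃ f g : ℂ[X], ∃ c,
    b = aeval (x p) f + y p * aeval (y p) g + c * (y p * x p) := by
  have hb : b ∈ Submodule.span ℂ (Set.range fun ij : ℕ × ℕ => y p ^ ij.1 * x p ^ ij.2) := by
    rw [span_monomials_eq_top]; trivial
  induction hb using Submodule.span_induction with
  | mem _ h =>
    obtain ⟨⟨i, j⟩, rfl⟩ := h
    rcases i with _ | i
    · exact ⟨X ^ j, 0, 0, by simp⟩
    · rcases j with _ | j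
      · exact ⟨0, X ^ i, 0, by simp [pow_succ']⟩
      · refine ⟨0, 0, (p ^ j)⁻¹ • (y p ^ i * x p ^ j), ?_⟩
        have h := x_pow_mul_y_pow p 1 j
        rw [pow_one, one_mul] at h
        simp only [map_zero, mul_zero, zero_add, smul_mul_assoc]
        rw [mul_assoc, ← mul_assoc (x p ^ j), h, smul_mul_assoc, mul_smul_comm, smul_smul,
          inv_mul_cancel₀ (pow_ne_zero _ hp0), one_smul, pow_succ, pow_succ]
        simp only [mul_assoc]
  | zero => exact ⟨0, 0, 0, by simp⟩
  | add a b _ _ ha hb =>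
    obtain ⟨f, g, c, rfl⟩ := ha
    obtain ⟨f', g', c', rfl⟩ := hb
    exact ⟨f + f', g + g', c + c', by simp only [map_add, mul_add, add_mul]; abel⟩
  | smul r a _ ha =>
    obtain ⟨f, g, c, rfl⟩ := ha
    exact ⟨r • f, r • g, r • c, by simp only [map_smul, smul_add, mul_smul_comm, smul_mul_assoc]⟩

theorem exists_eq_mul_of_modX_of_modY (hp0 : p ≠ 0) {b : QuantumPlane p} (hX : modX p b = 0)
    (hY : modY p b = 0) : ∃ c, b = c * (y p * x p) := by
  obtain ⟨f, g, c, rfl⟩ := exists_eq_aeval_add hp0 b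
  have hf : f = 0 := by
    simpa [← aeval_algHom_apply] using hY
  have hg : g = 0 := by
    simpa [← aeval_algHom_apply, hf] using hX
  exact ⟨c, by simp [hf, hg]⟩

/-- The element `xy` is normal: moving it across a trinomial only rescales the coefficients, by
nonzero factors. This trinomial shape is that of `e₂ e₃ e₁`. -/
theorem trinomial_mul (hp0 : p ≠ 0) (b s t : ℂ) :
    (b • 1 + s • y p + t • (x p * x p)) * (x p * y p)
      = (x p * y p) * (b • 1 + (s * p⁻¹) • y p + (t * p ^ 2) • (x p * x p)) := by
  have h1 : y p * (x p * y p) = p⁻¹ • (x p * (y p * y p)) := by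
    rw [← mul_assoc (x p) (y p) (y p), x_mul_y, smul_mul_assoc, mul_assoc, smul_smul,
      inv_mul_cancel₀ hp0, one_smul, x_mul_y]
  have h2 : x p * (x p * (x p * y p)) = p ^ 2 • (x p * (y p * (x p * x p))) := by
    rw [← mul_assoc (y p)]
    have : x p * (x p * y p) = p ^ 2 • (y p * x p * x p) := by
      rw [x_mul_y, mul_smul_comm, ← mul_assoc, x_mul_y, smul_mul_assoc, smul_smul, sq]
    rw [this, mul_smul_comm]
  simp only [add_mul, mul_add, smul_mul_assoc, mul_smul_comm, mul_assoc, h1, h2, one_mul, mul_one,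
    smul_smul]

theorem trinomial_mul_pow (hp0 : p ≠ 0) (n : ℕ) (b s t : ℂ) :
    (b • 1 + s • y p + t • (x p * x p)) * (x p * y p) ^ n
      = (x p * y p) ^ n * (b • 1 + (s * p⁻¹ ^ n) • y p + (t * (p ^ 2) ^ n) • (x p * x p)) := by
  induction n generalizing s t with
  | zero => simp
  | succ n ih =>
    rw [pow_succ', ← mul_assoc, trinomial_mul hp0, mul_assoc, ih, mul_assoc]
    simp only [pow_succ', mul_assoc]

end QuantumPlane

/-! ### Filtration by degree in `e₂` and the injectivity criterion -/

namespace FactorRelations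

open QuantumPlane

variable {p α γ : ℂ} {B : Type*} [Ring B] [Algebra ℂ B] {e₁ e₂ e₃ : B}

/-- The homomorphism from the quantum plane given by `x ↦ e₃`, `y ↦ e₁`. -/
noncomputable def ofPlane (h : FactorRelations p α γ e₁ e₂ e₃) : QuantumPlane p →ₐ[ℂ] B :=
  lift e₃ e₁ h.e₃_mul_e₁

variable (h : FactorRelations p α γ e₁ e₂ e₃)

@[simp] theorem ofPlane_x : h.ofPlane (x p) = e₃ := lift_x _ _ _
@[simp] theorem ofPlane_y : h.ofPlane (y p) = e₁ := lift_y _ _ _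

/-- This is the commutation rule of an Ore extension, `e₂ b = σ(b) e₂ + δ(b)`. Only the existence of
the two terms is needed, so `σ` and `δ` are not constructed as maps. -/
theorem e₂_mul_ofPlane (hp0 : p ≠ 0) (b : QuantumPlane p) :
    ∃ b' b'', e₂ * h.ofPlane b = h.ofPlane b' * e₂ + h.ofPlane b'' := by
  have hb : b ∈ Algebra.adjoin ℂ {x p, y p} := by rw [adjoin_eq_top]; trivial
  induction hb using Algebra.adjoin_induction with
  | mem b hb =>
    rcases hb with rfl | rfl
    · exact ⟨p • x p, α • 1, by simp [h.e₂_mul_e₃]⟩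
    · refine ⟨p⁻¹ • y p, -(p⁻¹ • x p), ?_⟩
      simp only [map_smul, map_neg, ofPlane_x, ofPlane_y, smul_mul_assoc, h.e₁_mul_e₂, smul_add,
        smul_smul, inv_mul_cancel₀ hp0, one_smul]
      abel
  | algebraMap r => exact ⟨algebraMap ℂ _ r, 0, by simp [Algebra.commutes]⟩
  | add b c _ _ hb hc =>
    obtain ⟨b', b'', hb⟩ := hb
    obtain ⟨c', c'', hc⟩ := hc
    exact ⟨b' + c', b'' + c'', by simp only [map_add, mul_add, add_mul, hb, hc]; abel⟩
  | mul b c _ _ hb hc =>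
    obtain ⟨b', b'', hb⟩ := hb
    obtain ⟨c', c'', hc⟩ := hc
    refine ⟨b' * c', b' * c'' + b'' * c, ?_⟩
    rw [map_mul, ← mul_assoc, hb, add_mul, mul_assoc, hc]
    simp only [map_add, map_mul, mul_add, mul_assoc, add_assoc]

/-- The elements of the form `∑ bⱼ e₂ʲ` with `j ≤ n`, where `bⱼ` is in the subalgebra generated by
`e₁` and `e₃`. -/
noncomputable def degreeLE : ℕ → Submodule ℂ B
  | 0 => LinearMap.range h.ofPlane.toLinearMap
  | n + 1 => degreeLE n ⊔
      LinearMap.range ((LinearMap.mulRight ℂ (e₂ ^ (n + 1))).comp h.ofPlane.toLinearMap)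

theorem mem_degreeLE_succ {n : ℕ} {a : B} : a ∈ h.degreeLE (n + 1) ↔
    ∃ a' ∈ h.degreeLE n, ∃ b, a = a' + h.ofPlane b * e₂ ^ (n + 1) := by
  simp [degreeLE, Submodule.mem_sup, eq_comm]

theorem degreeLE_mono : Monotone h.degreeLE :=
  monotone_nat_of_le_succ fun _ => le_sup_left

theorem ofPlane_mul_pow_mem (b : QuantumPlane p) (n : ℕ) :
    h.ofPlane b * e₂ ^ n ∈ h.degreeLE n := by
  cases n with
  | zero => exact ⟨b, by simp⟩
  | succ n => exact h.mem_degreeLE_succ.2 ⟨0, zero_mem _, b, by simp⟩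

theorem exists_mem_degreeLE (hp0 : p ≠ 0) (hgen : Algebra.adjoin ℂ {e₁, e₂} = ⊤) (a : B) :
    ∃ n, a ∈ h.degreeLE n := by
  have htop : Submodule.span ℂ
      (Set.range fun bn : QuantumPlane p × ℕ => h.ofPlane bn.1 * e₂ ^ bn.2) = ⊤ := by
    apply Submodule.eq_top_of_one_mem_of_adjoin _ hgen
    · exact Submodule.subset_span ⟨(1, 0), by simp⟩
    · intro s hs m hm
      induction hm using Submodule.span_induction with
      | zero => simp
      | add a b _ _ ha hb => rw [mul_add]; exact add_mem ha hb
      | smul c a _ ha => rw [mul_smul_comm]; exact Submodule.smul_mem _ _ ha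
      | mem a ha =>
        obtain ⟨⟨b, n⟩, rfl⟩ := ha
        rcases hs with rfl | rfl
        · exact Submodule.subset_span ⟨(y p * b, n), by simp [mul_assoc]⟩
        · obtain ⟨b', b'', hb⟩ := h.e₂_mul_ofPlane hp0 b
          simp only
          rw [← mul_assoc, hb, add_mul, mul_assoc, ← pow_succ']
          exact add_mem (Submodule.subset_span ⟨(b', n + 1), rfl⟩)
            (Submodule.subset_span ⟨(b'', n), rfl⟩)
  have ha : a ∈ Submodule.span ℂ
      (Set.range fun bn : QuantumPlane p × ℕ => h.ofPlane bn.1 * e₂ ^ bn.2) := by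
    rw [htop]; trivial
  induction ha using Submodule.span_induction with
  | zero => exact ⟨0, zero_mem _⟩
  | add a b _ _ ha hb =>
    obtain ⟨m, hm⟩ := ha
    obtain ⟨n, hn⟩ := hb
    exact ⟨m + n, add_mem (h.degreeLE_mono (by omega) hm) (h.degreeLE_mono (by omega) hn)⟩
  | smul c a _ ha =>
    obtain ⟨m, hm⟩ := ha
    exact ⟨m, Submodule.smul_mem _ _ hm⟩
  | mem a ha =>
    obtain ⟨⟨b, n⟩, rfl⟩ := ha
    exact ⟨n, h.ofPlane_mul_pow_mem b n⟩

theorem e₂_mul_ofPlane_x_mul_y (hp0 : p ≠ 0) (hp : p ^ 2 - 1 ≠ 0) :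
    e₂ * h.ofPlane (x p * y p) = h.ofPlane ((p * (p - p⁻¹)⁻¹ * γ) • 1 + (-(α / (p - 1))) • y p
      + (-(p * (p - p⁻¹)⁻¹)) • (x p * x p)) := by
  have hp1 : p - 1 ≠ 0 := by
    intro h0; apply hp; linear_combination (p + 1) * h0
  simp only [map_mul, map_add, map_smul, map_one, ofPlane_x, ofPlane_y]
  rw [← mul_assoc, h.e₂_mul_e₃, add_mul, smul_mul_assoc, mul_assoc, h.e₃_mul_e₂_mul_e₁,
    smul_mul_assoc, one_mul]
  match_scalars <;> (field_simp; try ring)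

/-- Since `e₂ (xy)` is a trinomial in the plane, moving the remaining factors `xy` across it makes
`P` a product of rescaled trinomials. The reductions land in the domain `ℂ[X]`, so each factor can
be checked separately. -/
theorem exists_e₂_pow_mul (hp0 : p ≠ 0) (hp : p ^ 2 - 1 ≠ 0) (hαγ : γ = 0 → α ≠ 0) (n : ℕ) :
    ∃ P, e₂ ^ n * h.ofPlane ((x p * y p) ^ n) = h.ofPlane P ∧ modX p P ≠ 0 ∧ modY p P ≠ 0 := by
  have hp1 : p - 1 ≠ 0 := by
    intro h0; apply hp; linear_combination (p + 1) * h0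
  have hp2 : p - p⁻¹ ≠ 0 := by
    intro h0; apply hp; field_simp at h0; linear_combination h0
  induction n with
  | zero => exact ⟨1, by simp⟩
  | succ n ih =>
    obtain ⟨P, hP, hX, hY⟩ := ih
    refine ⟨P * ((p * (p - p⁻¹)⁻¹ * γ) • 1 + (-(α / (p - 1)) * p⁻¹ ^ n) • y p
      + (-(p * (p - p⁻¹)⁻¹) * (p ^ 2) ^ n) • (x p * x p)), ?_, ?_, ?_⟩
    · rw [map_mul h.ofPlane P, ← hP, mul_assoc, ← map_mul, ← trinomial_mul_pow hp0,
        map_mul h.ofPlane _ (_ ^ n), ← h.e₂_mul_ofPlane_x_mul_y hp0 hp, pow_succ' (x p * y p),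
        map_mul h.ofPlane _ (_ ^ n), pow_succ]
      simp only [mul_assoc]
    · rw [map_mul]
      refine mul_ne_zero hX fun h0 => ?_
      -- Modulo `x`, the constant term is a nonzero multiple of `γ` and the linear term a nonzero
      -- multiple of `α`.
      have h1 := congrArg (coeff · 0) h0
      have h2 := congrArg (coeff · 1) h0
      simp [coeff_one, hp0, hp1, hp2] at h1 h2
      exact hαγ h1 h2
    · rw [map_mul]
      refine mul_ne_zero hY fun h0 => ?_
      -- Modulo `y`, the quadratic coefficient is nonzero whatever `α` and `γ` are.
      have h2 := congrArg (coeff · 2) h0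
      simp [coeff_one, ← sq, hp0, hp2] at h2

theorem exists_mul_ofPlane_eq (hp0 : p ≠ 0) (hp : p ^ 2 - 1 ≠ 0) (hαγ : γ = 0 → α ≠ 0) {n : ℕ}
    {a : B} (ha : a ∈ h.degreeLE n) : ∃ r, a * h.ofPlane ((x p * y p) ^ n) = h.ofPlane r := by
  induction n generalizing a with
  | zero =>
    obtain ⟨b, rfl⟩ := ha
    exact ⟨b, by simp⟩
  | succ n ih =>
    obtain ⟨a', ha', b, rfl⟩ := h.mem_degreeLE_succ.1 ha
    obtain ⟨r, hr⟩ := ih ha'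
    obtain ⟨P, hP, -⟩ := h.exists_e₂_pow_mul hp0 hp hαγ (n + 1)
    refine ⟨r * (x p * y p) + b * P, ?_⟩
    rw [add_mul, mul_assoc _ (e₂ ^ _), hP, pow_succ, map_mul, ← mul_assoc, hr, ← map_mul,
      ← map_mul, ← map_add]

/-- `e₁ e₃ e₂` is a multiple of `e₃ e₁ e₂ = e₃ e₃ + p e₃ e₂ e₁`, which lies in the plane, so one
factor `e₂` is absorbed. -/
theorem ofPlane_y_mul_x_mul_pow_mem (hp0 : p ≠ 0) (b : QuantumPlane p) (n : ℕ) :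
    h.ofPlane (b * (y p * x p)) * e₂ ^ (n + 1) ∈ h.degreeLE n := by
  have key : h.ofPlane (y p * x p) * e₂ = h.ofPlane (p⁻¹ • (x p * x p)
      + (p - p⁻¹)⁻¹ • (γ • 1 - ((1 + p⁻¹) * α) • y p - x p * x p)) := by
    simp only [map_mul, map_add, map_sub, map_smul, map_one, ofPlane_x, ofPlane_y]
    rw [← h.e₃_mul_e₂_mul_e₁]
    have : e₁ * e₃ = p⁻¹ • (e₃ * e₁) := by
      rw [h.e₃_mul_e₁, smul_smul, inv_mul_cancel₀ hp0, one_smul]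
    rw [this, smul_mul_assoc, mul_assoc, h.e₁_mul_e₂, mul_add, mul_smul_comm, smul_add, smul_smul,
      inv_mul_cancel₀ hp0, one_smul]
  rw [map_mul, mul_assoc, pow_succ', ← mul_assoc _ e₂, key, ← mul_assoc, ← map_mul]
  exact h.ofPlane_mul_pow_mem _ n

/-- A homomorphism out of an algebra generated by `e₁`, `e₂` is injective as soon as it is
injective on polynomials in `e₁`, `e₃`. -/
theorem injective_of_comp_ofPlane (hp0 : p ≠ 0) (hp : p ^ 2 - 1 ≠ 0) (hαγ : γ = 0 → α ≠ 0)
    (hgen : Algebra.adjoin ℂ {e₁, e₂} = ⊤) {K : Type*} [Ring K] [Algebra ℂ K] (φ : B →ₐ[ℂ] K)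
    (hφ : Function.Injective (φ.comp h.ofPlane)) : Function.Injective φ := by
  rw [injective_iff_map_eq_zero] at hφ ⊢
  intro a ha0
  obtain ⟨n, ha⟩ := h.exists_mem_degreeLE hp0 hgen a
  induction n with
  | zero =>
    obtain ⟨b, rfl⟩ := ha
    have : b = 0 := hφ b ha0
    simp [this]
  | succ n ih =>
    obtain ⟨a', ha', b, rfl⟩ := h.mem_degreeLE_succ.1 ha
    obtain ⟨r, hr⟩ := h.exists_mul_ofPlane_eq hp0 hp hαγ ha'
    obtain ⟨P, hP, hX, hY⟩ := h.exists_e₂_pow_mul hp0 hp hαγ (n + 1)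
    -- This is the kernel element times `(xy)ⁿ⁺¹`. The lower part retains a right factor `xy`, which
    -- dies modulo `x` and modulo `y`.
    have h0 : r * (x p * y p) + b * P = 0 := by
      apply hφ
      have : h.ofPlane (r * (x p * y p) + b * P)
          = (a' + h.ofPlane b * e₂ ^ (n + 1)) * h.ofPlane ((x p * y p) ^ (n + 1)) := by
        rw [add_mul, mul_assoc _ (e₂ ^ _), hP, pow_succ, map_mul _ (_ ^ n), ← mul_assoc a', hr,
          ← map_mul, ← map_mul, ← map_add]
      rw [AlgHom.comp_apply, this, map_mul, ha0, zero_mul]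
    have hbX : modX p b = 0 := by simpa [hX] using congrArg (modX p) h0
    have hbY : modY p b = 0 := by simpa [hY] using congrArg (modY p) h0
    obtain ⟨c, rfl⟩ := exists_eq_mul_of_modX_of_modY hp0 hbX hbY
    exact ih (add_mem ha' (h.ofPlane_y_mul_x_mul_pow_mem hp0 c n))

end FactorRelations

/-! ### Skew fields of fractions and embeddings -/

/-- The embedding of a domain satisfying the left Ore condition into its skew field of fractions. -/
noncomputable def SkewFrac.ofBase (R : Type*) [Ring R] [Algebra ℂ R]
    [OreLocalization.OreSet R⁰] : R →ₐ[ℂ] SkewFrac R :=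
  { OreLocalization.numeratorRingHom with commutes' := fun _ => rfl }

namespace SkewFrac

section
variable {R : Type*} [Ring R] [Algebra ℂ R] [OreLocalization.OreSet R⁰]

theorem ofBase_injective : Function.Injective (ofBase R) :=
  OreLocalization.numeratorHom_inj (S := R⁰) fun _ hx => hx.1

theorem exists_ofBase_mul_eq (k : SkewFrac R) :
    ∃ s ∈ R⁰, ∃ a, ofBase R s * k = ofBase R a := by
  induction k using OreLocalization.ind with
  | _ r s => exact ⟨s, s.2, r, OreLocalization.mul_cancel⟩

theorem exists_mul_ofBase_eq [IsDomain R] (hR : IsRightOre R) (k : SkewFrac R) :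
    ∃ s ∈ R⁰, ∃ a, k * ofBase R s = ofBase R a := by
  obtain ⟨s, hs, a, h⟩ := exists_ofBase_mul_eq k
  obtain ⟨a', s', hs', h'⟩ := hR a s (nonZeroDivisors.ne_zero hs)
  refine ⟨s', mem_nonZeroDivisors_of_ne_zero hs', a', ?_⟩
  have hs0 : ofBase R s ≠ 0 := (map_ne_zero_iff _ ofBase_injective).2 (nonZeroDivisors.ne_zero hs)
  apply mul_left_cancel₀ hs0
  rw [← mul_assoc, h, ← map_mul, h', map_mul]

end

section
variable {A K : Type*} [Ring A] [Algebra ℂ A] [DivisionRing K] [Algebra ℂ K] (φ : A →ₐ[ℂ] K)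

/-- Writing `φ(r) φ(s)⁻¹` as a left fraction of elements of `A` is exactly the left Ore condition
for `r` and `s`. -/
theorem nonempty_oreSet_of_embedding [IsDomain A] (hφ : Function.Injective φ)
    (hr : ∀ k : K, ∃ s ≠ 0, ∃ a, φ s * k = φ a) : Nonempty (OreLocalization.OreSet A⁰) := by
  rw [OreLocalization.nonempty_oreSet_iff_of_noZeroDivisors]
  rintro r ⟨s, hs⟩
  have hs0 : φ s ≠ 0 := (map_ne_zero_iff _ hφ).2 (nonZeroDivisors.ne_zero hs)
  obtain ⟨s', hs', a, h⟩ := hr (φ r * (φ s)⁻¹)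
  refine ⟨a, ⟨s', mem_nonZeroDivisors_of_ne_zero hs'⟩, hφ ?_⟩
  rw [map_mul, map_mul, ← h, ← mul_assoc, inv_mul_cancel_right₀ hs0]

theorem isRightOre_of_embedding (hφ : Function.Injective φ)
    (hl : ∀ k : K, ∃ s ≠ 0, ∃ a, k * φ s = φ a) : IsRightOre A := by
  intro r s hs
  have hs0 : φ s ≠ 0 := (map_ne_zero_iff _ hφ).2 hs
  obtain ⟨s', hs', a, h⟩ := hl ((φ s)⁻¹ * φ r)
  refine ⟨a, s', hs', hφ ?_⟩
  rw [map_mul, map_mul, ← h, mul_assoc, mul_inv_cancel_left₀ hs0]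

theorem nonempty_algEquiv_of_embedding [IsDomain A] [OreLocalization.OreSet A⁰]
    (hφ : Function.Injective φ)
    (hr : ∀ k : K, ∃ s ≠ 0, ∃ a, φ s * k = φ a) : Nonempty (SkewFrac A ≃ₐ[ℂ] K) := by
  have hunit : ∀ s : A⁰, IsUnit ((φ : A →* K).comp A⁰.subtype s) := fun s =>
    ((map_ne_zero_iff _ hφ).2 (nonZeroDivisors.ne_zero s.2)).isUnit
  let F : SkewFrac A →+* K := OreLocalization.universalHom (φ : A →+* K)
    (IsUnit.liftRight _ hunit) fun _ => rfl
  have hF : ∀ a, F (ofBase A a) = φ a := fun a => OreLocalization.universalHom_commutes _ _ _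
  let G : SkewFrac A →ₐ[ℂ] K := { F with
    commutes' := fun c => by
      rw [← AlgHom.commutes (ofBase A)]
      exact (hF _).trans (φ.commutes c) }
  refine ⟨AlgEquiv.ofBijective G ⟨F.injective, fun k => ?_⟩⟩
  obtain ⟨s, hs, a, h⟩ := hr k
  refine ⟨(ofBase A s)⁻¹ * ofBase A a, ?_⟩
  change F _ = k
  rw [map_mul, map_inv₀, hF, hF, ← h, inv_mul_cancel_left₀ ((map_ne_zero_iff _ hφ).2 hs)]

end

end SkewFrac

/-! ### The isomorphism of fraction fields -/

theorem corollary3p4 (q : ℂ) (hq0 : q ≠ 0) (hq : ∀ n : ℕ, 0 < n → q ^ n ≠ 1)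
    (α β : ℂ) (hαβ : (α, β) ≠ (0, 0)) :
    ∃ (_ : IsDomain (AlgA q α β)) (_ : IsDomain (QuantumPlane (q ^ 2)))
      (_ : OreLocalization.OreSet (AlgA q α β)⁰)
      (_ : OreLocalization.OreSet (QuantumPlane (q ^ 2))⁰),
      IsRightOre (AlgA q α β) ∧ IsRightOre (QuantumPlane (q ^ 2)) ∧
        Nonempty (SkewFrac (AlgA q α β) ≃ₐ[ℂ] SkewFrac (QuantumPlane (q ^ 2))) := by
  have hp0 : q ^ 2 ≠ 0 := pow_ne_zero 2 hq0
  have hp1 : (q ^ 2) ^ 2 - 1 ≠ 0 := by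
    rw [← pow_mul, sub_ne_zero]; exact hq 4 (by norm_num)
  have hp2 : 1 - (q ^ 2)⁻¹ ≠ 0 := by
    rw [sub_ne_zero, ne_comm, ne_eq, inv_eq_one]; exact hq 2 (by norm_num)
  have hinj : Function.Injective fun n : ℕ => (q ^ 2) ^ n := by
    have key : ∀ m n : ℕ, m < n → (q ^ 2) ^ m ≠ (q ^ 2) ^ n := fun m n hmn h => by
      refine hq (2 * (n - m)) (by omega) ?_
      rw [pow_mul, pow_sub₀ _ hp0 hmn.le, ← h, mul_inv_cancel₀ (pow_ne_zero _ hp0)]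
    intro m n h
    by_contra hne
    rcases lt_or_gt_of_ne hne with hlt | hlt
    exacts [key _ _ hlt h, key _ _ hlt h.symm]
  have hdom := QuantumPlane.isDomain hinj
  obtain ⟨hore⟩ := QuantumPlane.nonempty_oreSet hinj
  have hright := QuantumPlane.isRightOre hinj
  let ι := SkewFrac.ofBase (QuantumPlane (q ^ 2))
  have hι : Function.Injective ι := SkewFrac.ofBase_injective
  have hx : QuantumPlane.x (q ^ 2) ≠ 0 := fun h => Polynomial.X_ne_zero (R := ℂ) (by
    rw [← QuantumPlane.modY_x (q ^ 2), h, map_zero])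
  have hy : QuantumPlane.y (q ^ 2) ≠ 0 := fun h => Polynomial.X_ne_zero (R := ℂ) (by
    rw [← QuantumPlane.modX_y (q ^ 2), h, map_zero])
  have hιx : ι (QuantumPlane.x _) ≠ 0 := (map_ne_zero_iff _ hι).2 hx
  have hιy : ι (QuantumPlane.y _) ≠ 0 := (map_ne_zero_iff _ hι).2 hy
  have hAγ : β / (1 - (q ^ 2)⁻¹) = 0 → α ≠ 0 := by
    rintro h rfl
    exact hαβ (by simpa [hp2] using h)
  obtain ⟨φ, h₁, -, h₃⟩ := AlgA.exists_lift hq0 hp1 (factorRelations_divisionRing hp0 hp1 α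
    (β / (1 - (q ^ 2)⁻¹)) hιy hιx (by
      rw [← map_mul, ← map_mul, ← map_smul, QuantumPlane.x_mul_y]))
  have hA := AlgA.factorRelations α β hq0 hp1
  have hcomp : ∀ b, φ (hA.ofPlane b) = ι b := by
    intro b
    have : Algebra.adjoin ℂ {QuantumPlane.x (q ^ 2), QuantumPlane.y (q ^ 2)}
        ≤ AlgHom.equalizer (φ.comp hA.ofPlane) ι := by
      refine Algebra.adjoin_le ?_
      rintro _ (rfl | rfl)
      · simpa using h₃
      · simpa using h₁
    exact this (by rw [QuantumPlane.adjoin_eq_top]; trivial)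
  -- The plane embeds in `A_{α,β}` because composing with `φ` gives the injective `ι`.
  have hψ : Function.Injective hA.ofPlane := fun a b hab => hι (by rw [← hcomp, hab, hcomp])
  have hφ : Function.Injective φ := hA.injective_of_comp_ofPlane hp0 hp1 hAγ
    (AlgA.adjoin_eq_top q α β) φ fun a b hab => hι (by
      rw [← hcomp, ← hcomp]; exact hab)
  have hdomA : IsDomain (AlgA q α β) := hφ.isDomain φ.toRingHom
  -- Numerators and denominators can already be taken in the copy of the plane inside `A_{α,β}`.
  have hl : ∀ k, ∃ s ≠ 0, ∃ a, φ s * k = φ a := fun k => by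
    obtain ⟨s, hs, a, h⟩ := SkewFrac.exists_ofBase_mul_eq k
    exact ⟨hA.ofPlane s, (map_ne_zero_iff _ hψ).2 (nonZeroDivisors.ne_zero hs), hA.ofPlane a, by
      rw [hcomp, hcomp]; exact h⟩
  have hr : ∀ k, ∃ s ≠ 0, ∃ a, k * φ s = φ a := fun k => by
    obtain ⟨s, hs, a, h⟩ := SkewFrac.exists_mul_ofBase_eq hright k
    exact ⟨hA.ofPlane s, (map_ne_zero_iff _ hψ).2 (nonZeroDivisors.ne_zero hs), hA.ofPlane a, by
      rw [hcomp, hcomp]; exact h⟩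
  obtain ⟨horeA⟩ := SkewFrac.nonempty_oreSet_of_embedding φ hφ hl
  exact ⟨hdomA, hdom, horeA, hore, SkewFrac.isRightOre_of_embedding φ hφ hr, hright,
    SkewFrac.nonempty_algEquiv_of_embedding φ hφ hl⟩
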